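/- For $p\in[2,\infty)$ let $$C_p:=\sup\Big\{\frac{a\,b^p+b\,a^p}{a\,|b-t|^p+b\,|a+t|^p}\colon a>0,\ b>0,\ t\in\mathbb R\Big\}.$$ Let $n\ge 0$, and let $X_1,\dots,X_n$ be independent (strongly measurable) random vectors in a Banach space $(\mathfrak X,\|\cdot\|)$ such that $Y:=\|X_1+\dots+X_n\|$ has a finite mean. (i) Let $p\in[2,\infty)$, and let $c_1(p),c_2(p)\in[0,\infty)$ be any constants such that $$\mathsf E|\zeta_n|^p\le c_1(p)\sum_{i=1}^n\mathsf E|\xi_i|^p+c_2(p)\Big(\sum_{i=1}^n\big\|\mathsf E_{i-1}\xi_i^2\big\|_\infty\Big)^{p/2}$$ for all real-valued martingales $(\zeta_j)_{j=0}^n$ with $\zeta_0=0$ and differences $\xi_i:=\zeta_i-\zeta_{i-1}$, where $\mathsf E_j$ denotes the conditional expectation given $\zeta_0,\dots,\zeta_j$. Then, for all $x_1,\dots,x_n$ and $y_1,\dots,y_n$ in $\mathfrak X$, $$\mathsf E|Y-\mathsf E Y|^p\le C_p\,c_1(p)\sum_{i=1}^n\mathsf E\|X_i-x_i\|^p+c_2(p)\Big(\sum_{i=1}^n\mathsf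 E\|X_i-y_i\|^2\Big)^{p/2}.$$ (ii) For all $x_1,\dots,x_n$ in $\mathfrak X$, $$\operatorname{Var}Y\le\sum_{i=1}^n\mathsf E\|X_i-x_i\|^2.$$ Expectations of nonnegative random variables, conditional ones included, and the variance take values in $[0,\infty]$, with $0\cdot\infty=0$. -/

import Mathlib

open MeasureTheory ProbabilityTheory
open scoped ENNReal NNReal

universe u v

/-- The re-centering constant
`c_f = sup {(a f(b) + b f(-a)) / (a f(b - t) + b f(-a - t)) : a > 0, b > 0, t ∈ ℝ}` in `[0, ∞]`
of a nonnegative function `f : ℝ → ℝ` that vanishes only at `0`. -/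
noncomputable def recenteringConst (f : ℝ → ℝ) : ℝ≥0∞ :=
  ⨆ (a : ℝ) (_ : 0 < a) (b : ℝ) (_ : 0 < b) (t : ℝ),
    ENNReal.ofReal ((a * f b + b * f (-a)) / (a * f (b - t) + b * f (-a - t)))

/-- The constant `C_p = c_f` for `f = |·| ^ p`. -/
noncomputable def recenteringConstPow (p : ℝ) : ℝ≥0∞ :=
  recenteringConst fun x => |x| ^ p

/-- `c₁` and `c₂` are admissible constants in the Rosenthal-type inequality
`E |ζ_n| ^ p ≤ c₁ ∑ E |ξ_i| ^ p + c₂ (∑ ‖E_{i-1} ξ_i ^ 2‖_∞) ^ (p / 2)`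
for all real-valued martingales `ζ_0 = 0, ζ_1, …, ζ_n` with differences `ξ_i = ζ_i - ζ_{i-1}`, where
`E_j` is the conditional expectation given `ζ_0, …, ζ_j`. All expectations of nonnegative random
variables, the conditional ones included, are taken in `[0, ∞]`. -/
def IsMartingaleRosenthal (n : ℕ) (p : ℝ) (c₁ c₂ : ℝ≥0) : Prop :=
  ∀ (Ω : Type u) [MeasurableSpace Ω] (P : Measure Ω) [IsProbabilityMeasure P]
    (ζ : Fin (n + 1) → Ω → ℝ) (hζ : ∀ j, StronglyMeasurable (ζ j)),
    Martingale ζ (Filtration.natural ζ hζ) P → ζ 0 =ᵐ[P] 0 →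
      ∫⁻ ω, ‖ζ (Fin.last n) ω‖ₑ ^ p ∂P ≤
        c₁ * ∑ i : Fin n, ∫⁻ ω, ‖ζ i.succ ω - ζ i.castSucc ω‖ₑ ^ p ∂P +
        c₂ * (∑ i : Fin n, essSup
          (condLExp (Filtration.natural ζ hζ i.castSucc) P
            fun ω => ‖ζ i.succ ω - ζ i.castSucc ω‖ₑ ^ 2) P) ^ (p / 2)

/-!
With `S = ∑ i, X i`, the conditional means of `‖S‖ - E ‖S‖` given the first `j` summands form a
martingale that starts at `0` and ends at `‖S‖ - E ‖S‖`, so the assumed martingale inequality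
applies to it. By independence the conditional mean of `‖S‖` is `G_j (S_j)`, where `S_j` is the
sum of the first `j` summands and `G_j s = E ‖s + (S - S_j)‖` (`meanNormAdd`) is a 1-Lipschitz
function. This explicit version turns every conditional expectation into an iterated integral over
an independent pair.

Given the first `i` summands, the next difference is `G_{i+1} (S_i + X_i)` centered at its mean.
Subtracting the constant `G_{i+1} (S_i + x)` changes nothing, so the difference is a centered
version of a variable bounded by `‖X_i - x‖`. Centering increases the `p`-th moment at most by the
factor `C_p` (`lintegral_enorm_sub_mean_rpow_le`), and not at all for `p = 2`
(`recenteringConstPow_two_le_one`). Hence both the `p`-th moment and the conditional second moment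
of the difference are bounded as required (`setLIntegral_increment_le`).

The bound on the variance is the case `p = 2` with the constants `1` and `0`, which are admissible
by the orthogonality of martingale differences (`isMartingaleRosenthal_two`).

On a nonseparable space addition need not be measurable for the product of the Borel σ-algebras.
The argument is therefore carried out in the separable subspace spanned by the ranges of the `X i`
and the points `x i`, `y i`.
-/

/-! ### Re-centering a real random variable -/

theorem enorm_rpow_eq_ofReal {p : ℝ} (hp : 0 ≤ p) (x : ℝ) :
    ‖x‖ₑ ^ p = ENNReal.ofReal (|x| ^ p) := by
  rw [Real.enorm_eq_ofReal_abs, ENNReal.ofReal_rpow_of_nonneg (abs_nonneg x) hp]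

/-- The case of the re-centering inequality in which the centered variable takes the values `b` and
`-a` with weights proportional to `a` and `b`. -/
theorem two_point_le_recenteringConstPow {p : ℝ} (hp : 0 < p) {a b : ℝ} (ha : 0 < a) (hb : 0 < b)
    (t : ℝ) :
    ENNReal.ofReal a * ‖b‖ₑ ^ p + ENNReal.ofReal b * ‖-a‖ₑ ^ p ≤
      recenteringConstPow p *
        (ENNReal.ofReal a * ‖b - t‖ₑ ^ p + ENNReal.ofReal b * ‖-a - t‖ₑ ^ p) := by
  have key : ∀ x y : ℝ, ENNReal.ofReal a * ‖x‖ₑ ^ p + ENNReal.ofReal b * ‖y‖ₑ ^ p =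
      ENNReal.ofReal (a * |x| ^ p + b * |y| ^ p) := by
    intro x y
    rw [enorm_rpow_eq_ofReal hp.le, enorm_rpow_eq_ofReal hp.le, ← ENNReal.ofReal_mul ha.le,
      ← ENNReal.ofReal_mul hb.le, ← ENNReal.ofReal_add (by positivity) (by positivity)]
  rw [key, key]
  -- The denominator vanishes only if `t = b` and `t = -a`, which is excluded by `a, b > 0`.
  have hD : 0 < a * |b - t| ^ p + b * |-a - t| ^ p := by
    by_cases h : b - t = 0
    · have h2 : 0 < |-a - t| := abs_pos.mpr (by intro h'; linarith)
      positivity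
    · have h2 : 0 < |b - t| := abs_pos.mpr h
      positivity
  have hle : ENNReal.ofReal ((a * |b| ^ p + b * |-a| ^ p) / (a * |b - t| ^ p + b * |-a - t| ^ p)) ≤
      recenteringConstPow p := by
    unfold recenteringConstPow recenteringConst
    exact le_iSup_of_le a (le_iSup_of_le ha (le_iSup_of_le b (le_iSup_of_le hb
      (le_iSup_of_le t le_rfl))))
  calc ENNReal.ofReal (a * |b| ^ p + b * |-a| ^ p)
      = ENNReal.ofReal ((a * |b| ^ p + b * |-a| ^ p) / (a * |b - t| ^ p + b * |-a - t| ^ p)) *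
          ENNReal.ofReal (a * |b - t| ^ p + b * |-a - t| ^ p) := by
        rw [← ENNReal.ofReal_mul (by positivity), div_mul_cancel₀ _ hD.ne']
    _ ≤ _ := by gcongr

/-- Re-centering inequality: centering a random variable at its mean increases its `p`-th absolute
moment at most by the factor `recenteringConstPow p`. A centered variable is a mixture of centered
two-point variables; the mixture is realized by pairing the positive values of one copy of the
variable with the negative values of an independent copy. -/
theorem lintegral_enorm_sub_mean_rpow_le {Ω : Type*} [MeasurableSpace Ω] {P : Measure Ω}
    [IsProbabilityMeasure P] {p : ℝ} (hp : 0 < p) {U : Ω → ℝ} (hUm : Measurable U)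
    (hU : Integrable U P) :
    ∫⁻ ω, ‖U ω - ∫ ω', U ω' ∂P‖ₑ ^ p ∂P ≤ recenteringConstPow p * ∫⁻ ω, ‖U ω‖ₑ ^ p ∂P := by
  set m := ∫ ω', U ω' ∂P with hm
  set V : Ω → ℝ := fun ω => U ω - m with hV
  have hVm : Measurable V := hUm.sub_const m
  have hVi : Integrable V P := hU.sub (integrable_const m)
  have hV0 : ∫ ω, V ω ∂P = 0 := by
    rw [hV, integral_sub hU (integrable_const m)]
    simp [hm]
  set K := ∫⁻ ω, ENNReal.ofReal (V ω) ∂P with hK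
  have hKtop : K ≠ ∞ := hVi.lintegral_lt_top.ne
  have hKtop' : ∫⁻ ω, ENNReal.ofReal (-V ω) ∂P ≠ ∞ := hVi.neg.lintegral_lt_top.ne
  have hKneg : ∫⁻ ω, ENNReal.ofReal (-V ω) ∂P = K := by
    have h := integral_eq_lintegral_pos_part_sub_lintegral_neg_part hVi
    rw [hV0] at h
    exact ((ENNReal.toReal_eq_toReal_iff' hKtop hKtop').1 (by linarith)).symm
  -- `K = 0` means that `U` is almost surely constant; otherwise the final division by `K` is legal.
  rcases eq_or_ne K 0 with hK0 | hK0
  · have h1 : ∀ᵐ ω ∂P, ENNReal.ofReal (V ω) = 0 :=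
      (lintegral_eq_zero_iff hVm.ennreal_ofReal).1 (hK ▸ hK0)
    have h2 : ∀ᵐ ω ∂P, ENNReal.ofReal (-V ω) = 0 :=
      (lintegral_eq_zero_iff hVm.neg.ennreal_ofReal).1 (hKneg.trans hK0)
    have h3 : ∫⁻ ω, ‖V ω‖ₑ ^ p ∂P = 0 := by
      rw [lintegral_eq_zero_iff (by fun_prop)]
      filter_upwards [h1, h2] with ω h1 h2
      have : V ω = 0 := by
        rw [ENNReal.ofReal_eq_zero] at h1 h2
        linarith
      simp [this, hp]
    rw [h3]
    exact zero_le
  -- Integrating the weighted values at the pairs `V ω > 0`, `V ω' < 0` restores the integral over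
  -- `{V ≠ 0}`, with the factor `K`, because the positive and negative parts of `V` have equal mean.
  have pair : ∀ Φ : Ω → ℝ≥0∞, Measurable Φ →
      ∫⁻ ω, ∫⁻ ω', (ENNReal.ofReal (-V ω') * {ω | 0 < V ω}.indicator Φ ω +
        ENNReal.ofReal (V ω) * {ω | V ω < 0}.indicator Φ ω') ∂P ∂P =
      K * (∫⁻ ω, {ω | 0 < V ω}.indicator Φ ω ∂P + ∫⁻ ω, {ω | V ω < 0}.indicator Φ ω ∂P) := by
    intro Φ hΦ
    have hpos : Measurable ({ω | 0 < V ω}.indicator Φ) :=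
      hΦ.indicator (measurableSet_lt measurable_const hVm)
    have hneg : Measurable ({ω | V ω < 0}.indicator Φ) :=
      hΦ.indicator (measurableSet_lt hVm measurable_const)
    have hin : ∀ ω, ∫⁻ ω', (ENNReal.ofReal (-V ω') * {ω | 0 < V ω}.indicator Φ ω +
        ENNReal.ofReal (V ω) * {ω | V ω < 0}.indicator Φ ω') ∂P =
        K * {ω | 0 < V ω}.indicator Φ ω +
          ENNReal.ofReal (V ω) * ∫⁻ ω', {ω | V ω < 0}.indicator Φ ω' ∂P := by
      intro ω
      rw [lintegral_add_left (by fun_prop), lintegral_mul_const _ (by fun_prop), hKneg,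
        lintegral_const_mul _ hneg]
    simp_rw [hin]
    rw [lintegral_add_left (hpos.const_mul K), lintegral_const_mul _ hpos,
      lintegral_mul_const _ (by fun_prop), mul_add]
  have hΦ : Measurable fun ω => ‖V ω‖ₑ ^ p := by fun_prop
  have hΨ : Measurable fun ω => ‖U ω‖ₑ ^ p := by fun_prop
  have hposS : MeasurableSet {ω | 0 < V ω} := measurableSet_lt measurable_const hVm
  have hnegS : MeasurableSet {ω | V ω < 0} := measurableSet_lt hVm measurable_const
  have hmain : K * ∫⁻ ω, ‖V ω‖ₑ ^ p ∂P ≤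
      K * (recenteringConstPow p * ∫⁻ ω, ‖U ω‖ₑ ^ p ∂P) := by
    calc K * ∫⁻ ω, ‖V ω‖ₑ ^ p ∂P
        = K * (∫⁻ ω, {ω | 0 < V ω}.indicator (fun ω => ‖V ω‖ₑ ^ p) ω ∂P +
            ∫⁻ ω, {ω | V ω < 0}.indicator (fun ω => ‖V ω‖ₑ ^ p) ω ∂P) := by
          rw [← lintegral_add_left (hΦ.indicator hposS)]
          congr 1
          refine lintegral_congr fun ω => ?_
          rcases lt_trichotomy (V ω) 0 with h | h | h
          · simp [h, h.le]
          · simp [h, hp]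
          · simp [h, h.le]
      _ = ∫⁻ ω, ∫⁻ ω', (ENNReal.ofReal (-V ω') *
              {ω | 0 < V ω}.indicator (fun ω => ‖V ω‖ₑ ^ p) ω +
            ENNReal.ofReal (V ω) * {ω | V ω < 0}.indicator (fun ω => ‖V ω‖ₑ ^ p) ω') ∂P ∂P :=
          (pair _ hΦ).symm
      _ ≤ ∫⁻ ω, ∫⁻ ω', (ENNReal.ofReal (-V ω') *
              {ω | 0 < V ω}.indicator (fun ω => recenteringConstPow p * ‖U ω‖ₑ ^ p) ω +
            ENNReal.ofReal (V ω) *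
              {ω | V ω < 0}.indicator (fun ω => recenteringConstPow p * ‖U ω‖ₑ ^ p) ω')
              ∂P ∂P := by
          refine lintegral_mono fun ω => lintegral_mono fun ω' => ?_
          by_cases h : 0 < V ω
          · by_cases h' : V ω' < 0
            · have := two_point_le_recenteringConstPow hp (neg_pos.2 h') h (-m)
              simp only [Set.indicator, Set.mem_ofPred_eq, h, h', if_true]
              simp only [neg_neg, hV, sub_neg_eq_add, sub_add_cancel] at this
              refine this.trans (le_of_eq ?_)
              simp only [hV]
              ring
            · simp [h', ENNReal.ofReal_of_nonpos (neg_nonpos.2 (not_lt.1 h'))]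
          · simp [h, ENNReal.ofReal_of_nonpos (not_lt.1 h)]
      _ = K * (∫⁻ ω, {ω | 0 < V ω}.indicator (fun ω => recenteringConstPow p * ‖U ω‖ₑ ^ p) ω ∂P +
            ∫⁻ ω, {ω | V ω < 0}.indicator (fun ω => recenteringConstPow p * ‖U ω‖ₑ ^ p) ω ∂P) :=
          pair _ (hΨ.const_mul _)
      _ ≤ K * ∫⁻ ω, recenteringConstPow p * ‖U ω‖ₑ ^ p ∂P := by
          rw [← lintegral_add_left ((hΨ.const_mul _).indicator hposS)]
          gcongr with ω
          rcases lt_trichotomy (V ω) 0 with h | h | h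
          · simp [h, h.le]
          · simp [h]
          · simp [h, h.le]
      _ = _ := by rw [lintegral_const_mul _ hΨ]
  exact (ENNReal.mul_le_mul_iff_right hK0 hKtop).1 hmain

/-- Centering at the mean does not increase the second moment. -/
theorem recenteringConstPow_two_le_one : recenteringConstPow 2 ≤ 1 := by
  unfold recenteringConstPow recenteringConst
  refine iSup_le fun a => iSup_le fun ha => iSup_le fun b => iSup_le fun hb => iSup_le fun t => ?_
  rw [ENNReal.ofReal_le_one]
  simp only [Real.rpow_two, sq_abs]
  refine div_le_one_of_le₀ ?_ (by positivity)
  nlinarith [mul_nonneg (add_pos ha hb).le (sq_nonneg t)]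

/-! ### Integrals over independent pairs -/

section IndependentPairs

variable {Ω γ δ : Type*} [MeasurableSpace Ω] [MeasurableSpace γ] [MeasurableSpace δ]
  {P : Measure Ω} [IsProbabilityMeasure P] {U : Ω → γ} {V : Ω → δ}

theorem lintegral_comp_indepFun (hU : Measurable U) (hV : Measurable V) (h : IndepFun U V P)
    {φ : γ × δ → ℝ≥0∞} (hφ : Measurable φ) :
    ∫⁻ ω, φ (U ω, V ω) ∂P = ∫⁻ ω, ∫⁻ ω', φ (U ω, V ω') ∂P ∂P := by
  have := Measure.isProbabilityMeasure_map (μ := P) hV.aemeasurable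
  rw [← lintegral_map (f := φ) (g := fun ω => (U ω, V ω)) hφ (hU.prodMk hV),
    (indepFun_iff_map_prod_eq_prod_map_map hU.aemeasurable hV.aemeasurable).1 h,
    lintegral_prod _ hφ.aemeasurable, lintegral_map hφ.lintegral_prod_right' hU]
  refine lintegral_congr fun ω => ?_
  rw [lintegral_map (by fun_prop) hV]

theorem integral_comp_indepFun (hU : Measurable U) (hV : Measurable V) (h : IndepFun U V P)
    {φ : γ × δ → ℝ} (hφ : Measurable φ) (hi : Integrable (fun ω => φ (U ω, V ω)) P) :
    ∫ ω, φ (U ω, V ω) ∂P = ∫ ω, ∫ ω', φ (U ω, V ω') ∂P ∂P := by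
  have := Measure.isProbabilityMeasure_map (μ := P) hV.aemeasurable
  have := Measure.isProbabilityMeasure_map (μ := P) hU.aemeasurable
  have hmap := (indepFun_iff_map_prod_eq_prod_map_map hU.aemeasurable hV.aemeasurable).1 h
  have hi' : Integrable φ ((P.map U).prod (P.map V)) := by
    rw [← hmap]
    exact (integrable_map_measure hφ.aestronglyMeasurable (hU.prodMk hV).aemeasurable).2 hi
  rw [← integral_map (φ := fun ω => (U ω, V ω)) (hU.prodMk hV).aemeasurable
      hφ.aestronglyMeasurable, hmap, integral_prod _ hi',
    integral_map hU.aemeasurable hφ.stronglyMeasurable.integral_prod_right'.aestronglyMeasurable]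
  refine integral_congr_ae (.of_forall fun ω => ?_)
  exact integral_map (f := fun y => φ (U ω, y)) hV.aemeasurable
    (hφ.comp measurable_prodMk_left).aestronglyMeasurable

end IndependentPairs

/-! ### The mean norm after adding an independent tail -/

/-- The mean `E ‖s + R‖` as a function of the point `s`. When `R` is the sum of the summands not yet
revealed, its value at the sum of the revealed ones is the conditional mean of the norm of the total
sum. -/
noncomputable def meanNormAdd {Ω E : Type*} [MeasurableSpace Ω] [NormedAddCommGroup E]
    (P : Measure Ω) (R : Ω → E) (s : E) : ℝ :=
  ∫ ω, ‖s + R ω‖ ∂P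

theorem lipschitzWith_meanNormAdd {Ω E : Type*} [MeasurableSpace Ω] [NormedAddCommGroup E]
    {P : Measure Ω} [IsProbabilityMeasure P] {R : Ω → E} (hR : Integrable R P) :
    LipschitzWith 1 (meanNormAdd P R) := by
  refine LipschitzWith.of_dist_le_mul fun s t => ?_
  have hi : ∀ s : E, Integrable (fun ω => ‖s + R ω‖) P := fun s =>
    ((integrable_const s).add hR).norm
  rw [NNReal.coe_one, one_mul, Real.dist_eq, meanNormAdd, meanNormAdd,
    ← integral_sub (hi s) (hi t), dist_eq_norm]
  refine (abs_integral_le_integral_abs).trans ?_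
  calc ∫ ω, |‖s + R ω‖ - ‖t + R ω‖| ∂P ≤ ∫ _, ‖s - t‖ ∂P := by
        refine integral_mono ((hi s).sub (hi t)).abs (integrable_const _) fun ω => ?_
        refine (abs_norm_sub_norm_le _ _).trans_eq ?_
        simp
    _ = ‖s - t‖ := by simp

section MeanNorm

variable {Ω E : Type*} [MeasurableSpace Ω] [NormedAddCommGroup E] [MeasurableSpace E]
  [BorelSpace E] [SecondCountableTopology E] {P : Measure Ω} [IsProbabilityMeasure P]

theorem integral_meanNormAdd_add {V R : Ω → E} (hVm : Measurable V) (hRm : Measurable R)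
    (hV : Integrable V P) (hR : Integrable R P) (h : IndepFun V R P) (s : E) :
    ∫ ω, meanNormAdd P R (s + V ω) ∂P = meanNormAdd P (fun ω => V ω + R ω) s := by
  have := integral_comp_indepFun (φ := fun z : E × E => ‖s + z.1 + z.2‖) hVm hRm h (by fun_prop)
    (((integrable_const s).add hV).add hR).norm
  simp only [meanNormAdd, ← add_assoc]
  exact this.symm

/-- `meanNormAdd P R` at the revealed sum is the conditional mean of the norm of the total sum given
the revealed information `W`. -/
theorem setIntegral_meanNormAdd {γ : Type*} [MeasurableSpace γ] {W : Ω → γ} {s : γ → E}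
    {R : Ω → E} (hW : Measurable W) (hs : Measurable s) (hRm : Measurable R) (h : IndepFun W R P)
    (hsW : Integrable (fun ω => s (W ω)) P) (hR : Integrable R P) {B : Set γ}
    (hB : MeasurableSet B) :
    ∫ ω in W ⁻¹' B, meanNormAdd P R (s (W ω)) ∂P = ∫ ω in W ⁻¹' B, ‖s (W ω) + R ω‖ ∂P := by
  rw [← integral_indicator (hW hB), ← integral_indicator (hW hB)]
  have hm : Measurable fun z : γ × E => (Prod.fst ⁻¹' B).indicator (fun z => ‖s z.1 + z.2‖) z :=
    Measurable.indicator (by fun_prop) (measurable_fst hB)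
  have := integral_comp_indepFun hW hRm h hm ((hsW.add hR).norm.indicator (hW hB))
  refine Eq.trans ?_ this.symm
  refine integral_congr_ae (.of_forall fun ω => ?_)
  by_cases hω : W ω ∈ B <;> simp [hω, meanNormAdd, Set.indicator]

/-- A summand of an integrable sum of two independent vectors is integrable, as it is integrable
after a shift by almost every value of the other summand. -/
theorem integrable_of_integrable_norm_add {V Q : Ω → E} (hVm : Measurable V) (hQm : Measurable Q)
    (h : IndepFun Q V P) (hi : Integrable (fun ω => ‖Q ω + V ω‖) P) : Integrable V P := by
  have h1 := lintegral_comp_indepFun (φ := fun z : E × E => ‖z.1 + z.2‖ₑ) hQm hVm h (by fun_prop)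
  have h2 : ∫⁻ ω, ‖Q ω + V ω‖ₑ ∂P ≠ ∞ := by
    have := hi.hasFiniteIntegral
    simpa [HasFiniteIntegral] using this.ne
  simp only at h1
  have hm : Measurable fun q : E => ∫⁻ ω', ‖q + V ω'‖ₑ ∂P :=
    Measurable.lintegral_prod_right' (f := fun z : E × Ω => ‖z.1 + V z.2‖ₑ) (by fun_prop)
  have h3 := ae_lt_top (hm.comp hQm) (h1 ▸ h2)
  obtain ⟨ω, hω⟩ := h3.exists
  have h4 : Integrable (fun ω' => Q ω + V ω') P :=
    ⟨(by fun_prop : Measurable fun ω' => Q ω + V ω').aestronglyMeasurable, hω⟩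
  exact (h4.sub (integrable_const (Q ω))).congr (.of_forall fun ω' => by simp)

end MeanNorm

/-! ### Increments of a Lipschitz function along an independent summand -/

/-- The conditional `p`-th moment of the centered increment `G (s + V) - E G (s + V)`, given
information `W` that is independent of `V` and determines `s`. Given `W`, the increment is
`G (s + V) - G (s + x)` centered at its mean, and `|G (s + V) - G (s + x)| ≤ ‖V - x‖`. -/
theorem setLIntegral_increment_le {Ω E γ : Type*} [MeasurableSpace Ω] [NormedAddCommGroup E]
    [MeasurableSpace E] [BorelSpace E] [SecondCountableTopology E] [MeasurableSpace γ]
    {P : Measure Ω} [IsProbabilityMeasure P] {p : ℝ} (hp : 0 < p) {W : Ω → γ} {s : γ → E}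
    {V : Ω → E} {G : E → ℝ} (hW : Measurable W) (hs : Measurable s) (hVm : Measurable V)
    (h : IndepFun W V P) (hV : Integrable V P) (hG : LipschitzWith 1 G) {B : Set γ}
    (hB : MeasurableSet B) (x : E) :
    ∫⁻ ω in W ⁻¹' B, ‖G (s (W ω) + V ω) - ∫ ω', G (s (W ω) + V ω') ∂P‖ₑ ^ p ∂P ≤
      recenteringConstPow p * (∫⁻ ω, ‖V ω - x‖ₑ ^ p ∂P) * P (W ⁻¹' B) := by
  have hGm : Measurable G := hG.continuous.measurable
  have hint : Measurable fun w : γ => ∫ ω', G (s w + V ω') ∂P :=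
    (StronglyMeasurable.integral_prod_right' (f := fun z : γ × Ω => G (s z.1 + V z.2))
      (by fun_prop : Measurable fun z : γ × Ω => G (s z.1 + V z.2)).stronglyMeasurable).measurable
  have hφ : Measurable fun z : γ × E => (Prod.fst ⁻¹' B).indicator
      (fun z : γ × E => ‖G (s z.1 + z.2) - ∫ ω', G (s z.1 + V ω') ∂P‖ₑ ^ p) z :=
    Measurable.indicator
      (((hGm.comp (by fun_prop)).sub (hint.comp measurable_fst)).enorm.pow_const p)
      (measurable_fst hB)
  rw [← lintegral_indicator (hW hB)]
  have h1 := lintegral_comp_indepFun hW hVm h hφ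
  have h2 : ∀ w : γ, ∫⁻ ω', ‖G (s w + V ω') - ∫ ω', G (s w + V ω') ∂P‖ₑ ^ p ∂P ≤
      recenteringConstPow p * ∫⁻ ω, ‖V ω - x‖ₑ ^ p ∂P := by
    intro w
    have hbound : ∀ ω, ‖G (s w + V ω) - G (s w + x)‖ ≤ ‖V ω - x‖ := by
      intro ω
      have := hG.dist_le_mul (s w + V ω) (s w + x)
      simpa [dist_eq_norm] using this
    have hU : Integrable (fun ω => G (s w + V ω) - G (s w + x)) P :=
      (hV.sub (integrable_const x)).mono
        (by fun_prop : Measurable fun ω => G (s w + V ω) - G (s w + x)).aestronglyMeasurable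
        (.of_forall hbound)
    have hGi : Integrable (fun ω => G (s w + V ω)) P :=
      (hU.add (integrable_const (G (s w + x)))).congr (.of_forall fun ω => by simp)
    have hmean : ∫ ω, G (s w + V ω) - G (s w + x) ∂P = ∫ ω, G (s w + V ω) ∂P - G (s w + x) := by
      rw [integral_sub hGi (integrable_const _)]
      simp
    have h3 := lintegral_enorm_sub_mean_rpow_le hp (by fun_prop) hU
    simp only [hmean, sub_sub_sub_cancel_right] at h3
    refine h3.trans ?_
    gcongr with ω
    exact enorm_le_iff_norm_le.2 (hbound ω)
  calc _ = ∫⁻ ω, ∫⁻ ω', (Prod.fst ⁻¹' B).indicator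
        (fun z : γ × E => ‖G (s z.1 + z.2) - ∫ ω', G (s z.1 + V ω') ∂P‖ₑ ^ p) (W ω, V ω') ∂P ∂P := by
        rw [← h1]
        rfl
    _ ≤ ∫⁻ ω, (W ⁻¹' B).indicator
          (fun _ => recenteringConstPow p * ∫⁻ ω, ‖V ω - x‖ₑ ^ p ∂P) ω ∂P := by
        refine lintegral_mono fun ω => ?_
        by_cases hω : W ω ∈ B
        · simpa [Set.indicator, hω] using h2 (W ω)
        · simp [Set.indicator, hω]
    _ = _ := by rw [lintegral_indicator_const (hW hB)]

theorem essSup_condLExp_le {Ω : Type*} {m m₀ : MeasurableSpace Ω} (hm : m ≤ m₀) {P : Measure[m₀] Ω}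
    [IsProbabilityMeasure P] {f : Ω → ℝ≥0∞} {K : ℝ≥0∞}
    (h : ∀ A, MeasurableSet[m] A → ∫⁻ ω in A, f ω ∂P ≤ K * P A) :
    essSup (condLExp m P f) P ≤ K := by
  refine essSup_le_of_ae_le K (ae_le_of_ae_le_trim (hm := hm) ?_)
  refine ae_le_of_forall_setLIntegral_le_of_sigmaFinite (measurable_condLExp _ _ _) fun A hA _ => ?_
  rw [setLIntegral_condLExp_trim hm _ _ hA, setLIntegral_const, trim_measurableSet_eq hm hA]
  exact h A hA

/-! ### Martingales with square-integrable differences -/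

/-- The orthogonality of martingale differences: for `p = 2` the constants `1` and `0` are
admissible. -/
theorem isMartingaleRosenthal_two (n : ℕ) : IsMartingaleRosenthal.{u} n 2 1 0 := by
  intro Ω _ P _ ζ hζ hmart h0
  simp only [ENNReal.coe_one, one_mul, ENNReal.coe_zero, zero_mul, add_zero]
  set D : Fin n → Ω → ℝ := fun i ω => ζ i.succ ω - ζ i.castSucc ω with hD
  -- Unless all differences are square-integrable, the right side is infinite.
  by_cases hfin : ∑ i : Fin n, ∫⁻ ω, ‖ζ i.succ ω - ζ i.castSucc ω‖ₑ ^ (2 : ℝ) ∂P = ∞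
  · rw [hfin]; exact le_top
  have hDm : ∀ i, AEStronglyMeasurable (D i) P := fun i =>
    ((hζ i.succ).sub (hζ i.castSucc)).aestronglyMeasurable
  have hDL : ∀ i, MemLp (D i) 2 P := by
    intro i
    refine ⟨hDm i, ?_⟩
    rw [eLpNorm_lt_top_iff_lintegral_rpow_enorm_lt_top (by simp) (by simp)]
    refine lt_of_le_of_ne le_top fun h => hfin ?_
    exact ENNReal.sum_eq_top.2 ⟨i, Finset.mem_univ _, by simpa using h⟩
  have hsq : ∀ {f : Ω → ℝ}, MemLp f 2 P →
      ∫⁻ ω, ‖f ω‖ₑ ^ (2 : ℝ) ∂P = ENNReal.ofReal (∫ ω, f ω ^ 2 ∂P) := by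
    intro f hf
    rw [ofReal_integral_eq_lintegral_ofReal hf.integrable_sq (.of_forall fun ω => sq_nonneg _)]
    refine lintegral_congr fun ω => ?_
    rw [enorm_rpow_eq_ofReal (by norm_num), Real.rpow_two, sq_abs]
  have key : ∀ j : Fin (n + 1), MemLp (ζ j) 2 P ∧ ∫ ω, ζ j ω ^ 2 ∂P =
      ∑ i ∈ Finset.univ.filter (fun i : Fin n => i.castSucc < j), ∫ ω, D i ω ^ 2 ∂P := by
    intro j
    induction j using Fin.induction with
    | zero =>
      refine ⟨(memLp_congr_ae h0).2 MemLp.zero, ?_⟩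
      rw [Finset.filter_false_of_mem (by simp), Finset.sum_empty]
      rw [integral_congr_ae (g := fun _ => 0) (by filter_upwards [h0] with ω hω; simp [hω])]
      simp
    | succ i ih =>
      obtain ⟨ihL, ihI⟩ := ih
      have hsum : ζ i.succ = ζ i.castSucc + D i := by
        ext ω; simp [hD]
      refine ⟨hsum ▸ ihL.add (hDL i), ?_⟩
      have hprod : Integrable (ζ i.castSucc * D i) P := ihL.integrable_mul (hDL i)
      have hDint : Integrable (D i) P := (hmart.integrable _).sub (hmart.integrable _)
      have hcross : ∫ ω, ζ i.castSucc ω * D i ω ∂P = 0 := by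
        have hcond : P[D i | Filtration.natural ζ hζ i.castSucc] =ᵐ[P] 0 := by
          have h1 := condExp_sub (hmart.integrable i.succ) (hmart.integrable i.castSucc)
            (Filtration.natural ζ hζ i.castSucc)
          have h2 := hmart.condExp_ae_eq (Fin.castSucc_lt_succ (i := i)).le
          have h3 := hmart.condExp_ae_eq (le_refl i.castSucc)
          have h4 : D i = ζ i.succ - ζ i.castSucc := rfl
          rw [h4]
          filter_upwards [h1, h2, h3] with ω h1 h2 h3
          simp [h1, h2, h3]
        have h5 := condExp_mul_of_stronglyMeasurable_left (hmart.1 i.castSucc) hprod hDint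
        have h6 : ∫ ω, (ζ i.castSucc * D i) ω ∂P = 0 := by
          rw [← integral_condExp ((Filtration.natural ζ hζ).le i.castSucc),
            integral_congr_ae (g := fun _ => 0)]
          · simp
          · filter_upwards [h5, hcond] with ω h5 hc
            simp [h5, hc]
        exact h6
      have hexp : ∫ ω, ζ i.succ ω ^ 2 ∂P =
          ∫ ω, ζ i.castSucc ω ^ 2 ∂P + ∫ ω, D i ω ^ 2 ∂P := by
        have : ∀ ω, ζ i.succ ω ^ 2 =
            (ζ i.castSucc ω ^ 2 + D i ω ^ 2) + 2 * (ζ i.castSucc ω * D i ω) := by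
          intro ω
          rw [hsum]
          simp only [Pi.add_apply]
          ring
        simp_rw [this]
        rw [integral_add
            (f := fun ω => ζ i.castSucc ω ^ 2 + D i ω ^ 2)
            (g := fun ω => 2 * (ζ i.castSucc ω * D i ω))
            (ihL.integrable_sq.add (hDL i).integrable_sq) (Integrable.const_mul hprod 2),
          integral_add ihL.integrable_sq (hDL i).integrable_sq, integral_const_mul, hcross]
        simp
      have hfil : Finset.univ.filter (fun k : Fin n => k.castSucc < i.succ) =
          insert i (Finset.univ.filter (fun k : Fin n => k.castSucc < i.castSucc)) := by
        ext k
        simp [le_iff_eq_or_lt]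
      rw [hexp, ihI, hfil, Finset.sum_insert (by simp), add_comm]
  obtain ⟨hL, hI⟩ := key (Fin.last n)
  rw [hsq hL, hI, Finset.filter_true_of_mem (by simp [Fin.castSucc_lt_last]),
    ENNReal.ofReal_sum_of_nonneg fun i _ => integral_nonneg fun ω => sq_nonneg _]
  exact Finset.sum_le_sum fun i _ => (hsq (hDL i)).ge

/-! ### The conditional means of the norm as a martingale -/

section PartialSums

variable {Ω : Type*} {E : Type*} [AddCommMonoid E] {n : ℕ}

/-- The sum of the first `j` summands. -/
def headSum (X : Fin n → Ω → E) (j : Fin (n + 1)) (ω : Ω) : E :=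
  ∑ i with i.castSucc < j, X i ω

/-- The sum of all but the first `j` summands. -/
def tailSum (X : Fin n → Ω → E) (j : Fin (n + 1)) (ω : Ω) : E :=
  ∑ i with ¬ i.castSucc < j, X i ω

theorem headSum_zero (X : Fin n → Ω → E) (ω : Ω) : headSum X 0 ω = 0 := by
  simp [headSum]

theorem tailSum_zero (X : Fin n → Ω → E) (ω : Ω) : tailSum X 0 ω = ∑ i, X i ω := by
  simp [tailSum]

theorem headSum_last (X : Fin n → Ω → E) (ω : Ω) : headSum X (Fin.last n) ω = ∑ i, X i ω := by
  simp [headSum, Fin.castSucc_lt_last]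

theorem tailSum_last (X : Fin n → Ω → E) (ω : Ω) : tailSum X (Fin.last n) ω = 0 := by
  simp [tailSum, Fin.castSucc_lt_last]

theorem headSum_add_tailSum (X : Fin n → Ω → E) (j : Fin (n + 1)) (ω : Ω) :
    headSum X j ω + tailSum X j ω = ∑ i, X i ω :=
  Finset.sum_filter_add_sum_filter_not _ _ _

theorem headSum_succ (X : Fin n → Ω → E) (i : Fin n) (ω : Ω) :
    headSum X i.succ ω = headSum X i.castSucc ω + X i ω := by
  have : Finset.univ.filter (fun k : Fin n => k.castSucc < i.succ) =
      insert i (Finset.univ.filter (fun k : Fin n => k.castSucc < i.castSucc)) := by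
    ext k
    simp [le_iff_eq_or_lt]
  rw [headSum, this, Finset.sum_insert (by simp), headSum, add_comm]

theorem tailSum_castSucc (X : Fin n → Ω → E) (i : Fin n) (ω : Ω) :
    tailSum X i.castSucc ω = X i ω + tailSum X i.succ ω := by
  have : Finset.univ.filter (fun k : Fin n => ¬ k.castSucc < i.castSucc) =
      insert i (Finset.univ.filter (fun k : Fin n => ¬ k.castSucc < i.succ)) := by
    ext k
    simp only [Finset.mem_filter, Finset.mem_univ, true_and, Finset.mem_insert, Fin.lt_def,
      Fin.ext_iff, Fin.val_castSucc, Fin.val_succ]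
    omega
  rw [tailSum, this, Finset.sum_insert (by simp), tailSum]

end PartialSums

/-- The tuple of the first `j` summands. -/
def headTuple {Ω E : Type*} {n : ℕ} (X : Fin n → Ω → E) (j : Fin (n + 1)) (ω : Ω) :
    ({i : Fin n | i.castSucc < j} : Finset (Fin n)) → E :=
  fun i => X i ω

theorem headSum_eq_sum_headTuple {Ω E : Type*} [AddCommMonoid E] {n : ℕ} (X : Fin n → Ω → E)
    (j : Fin (n + 1)) (ω : Ω) : headSum X j ω = ∑ i, headTuple X j ω i :=
  (Finset.sum_coe_sort _ fun i => X i ω).symm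

/-- The martingale of the conditional means of `‖∑ i, X i‖` given the first `j` of the independent
summands `X i`, centered at the mean. -/
noncomputable def normMartingale {Ω E : Type*} [MeasurableSpace Ω] [NormedAddCommGroup E] {n : ℕ}
    (P : Measure Ω) (X : Fin n → Ω → E) (j : Fin (n + 1)) (ω : Ω) : ℝ :=
  meanNormAdd P (tailSum X j) (headSum X j ω) - ∫ ω', ‖∑ i, X i ω'‖ ∂P

theorem measurable_headTuple {Ω E : Type*} [MeasurableSpace Ω] [MeasurableSpace E] {n : ℕ}
    {X : Fin n → Ω → E} (hX : ∀ i, Measurable (X i)) (j : Fin (n + 1)) :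
    Measurable (headTuple X j) :=
  measurable_pi_lambda _ fun i => hX i

theorem integrable_tailSum {Ω E : Type*} [MeasurableSpace Ω] [NormedAddCommGroup E] {n : ℕ}
    {P : Measure Ω} {X : Fin n → Ω → E} (hXi : ∀ i, Integrable (X i) P) (j : Fin (n + 1)) :
    Integrable (tailSum X j) P :=
  integrable_finsetSum _ fun i _ => hXi i

theorem indepFun_tailSum {Ω E : Type*} [MeasurableSpace Ω] [NormedAddCommGroup E]
    [MeasurableSpace E] [BorelSpace E] [SecondCountableTopology E] {P : Measure Ω} {n : ℕ}
    {X : Fin n → Ω → E} (hX : ∀ i, Measurable (X i)) (hind : iIndepFun X P) (i : Fin n) :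
    IndepFun (X i) (tailSum X i.succ) P := by
  have h := hind.indepFun_finsetSum_of_notMem hX
    (s := Finset.univ.filter fun k : Fin n => ¬ k.castSucc < i.succ) (i := i) (by simp)
  convert h.symm using 1
  ext1 ω
  simp [tailSum]

theorem indepFun_headTuple {Ω E : Type*} [MeasurableSpace Ω] [MeasurableSpace E]
    {P : Measure Ω} {n : ℕ} {X : Fin n → Ω → E} 
    (hX : ∀ i, Measurable (X i)) (hind : iIndepFun X P) (i : Fin n) :
    IndepFun (headTuple X i.castSucc) (X i) P :=
  (hind.indepFun_finset _ _ (Finset.disjoint_filter_filter_not Finset.univ Finset.univ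
    (fun k : Fin n => k.castSucc < i.castSucc)) hX).comp measurable_id
    (measurable_pi_apply (⟨i, by simp⟩ :
      ({k : Fin n | ¬ k.castSucc < i.castSucc} : Finset (Fin n))))

theorem indepFun_headTuple_tailSum {Ω E : Type*} [MeasurableSpace Ω] [NormedAddCommGroup E]
    [MeasurableSpace E] [BorelSpace E] [SecondCountableTopology E] {P : Measure Ω} {n : ℕ}
    {X : Fin n → Ω → E} (hX : ∀ i, Measurable (X i)) (hind : iIndepFun X P)
    (j : Fin (n + 1)) : IndepFun (headTuple X j) (tailSum X j) P := by
  have h := (hind.indepFun_finset _ _ (Finset.disjoint_filter_filter_not Finset.univ Finset.univ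
    (fun i : Fin n => i.castSucc < j)) hX).comp
    (ψ := fun w : ({i : Fin n | ¬ i.castSucc < j} : Finset (Fin n)) → E => ∑ i, w i)
    measurable_id (by fun_prop)
  have htail : tailSum X j = (fun w : ({i : Fin n | ¬ i.castSucc < j} : Finset (Fin n)) → E =>
      ∑ i, w i) ∘ fun ω i => X i ω := by
    ext1 ω
    exact (Finset.sum_coe_sort _ fun i => X i ω).symm
  rw [htail]
  exact h

section Separable

variable {Ω E : Type*} [MeasurableSpace Ω] [NormedAddCommGroup E]
  [MeasurableSpace E] [BorelSpace E] [SecondCountableTopology E] {P : Measure Ω}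
  [IsProbabilityMeasure P] {n : ℕ} {X : Fin n → Ω → E}

theorem integrable_summand (hX : ∀ i, Measurable (X i)) (hind : iIndepFun X P)
    (hi : Integrable (fun ω => ‖∑ i, X i ω‖) P) (i : Fin n) : Integrable (X i) P := by
  have h := hind.indepFun_finsetSum_of_notMem hX (s := Finset.univ.erase i) (i := i) (by simp)
  refine integrable_of_integrable_norm_add (Q := ∑ k ∈ Finset.univ.erase i, X k) (hX i)
    (by rw [Finset.sum_fn]; fun_prop) h
    (hi.congr (.of_forall fun ω => ?_))
  simp only [Finset.sum_apply]
  rw [Finset.sum_erase_add _ _ (Finset.mem_univ i)]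

theorem measurable_tailSum (hX : ∀ i, Measurable (X i)) (j : Fin (n + 1)) :
    Measurable (tailSum X j) :=
  Finset.measurable_fun_sum _ fun i _ => hX i

theorem normMartingale_measurable_headTuple (hXi : ∀ i, Integrable (X i) P) {k j : Fin (n + 1)}
    (hkj : k ≤ j) :
    Measurable[MeasurableSpace.comap (headTuple X j) inferInstance] (normMartingale P X k) := by
  have hG : Measurable (meanNormAdd P (tailSum X k)) :=
    (lipschitzWith_meanNormAdd (integrable_tailSum hXi k)).continuous.measurable
  refine (hG.comp ?_).sub_const _
  refine Finset.measurable_fun_sum _ fun i hi => ?_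
  have hi' : i.castSucc < j := ((Finset.mem_filter.1 hi).2).trans_le hkj
  exact (measurable_pi_apply (⟨i, by simpa using hi'⟩ :
    ({i : Fin n | i.castSucc < j} : Finset (Fin n)))).comp (comap_measurable (headTuple X j))

theorem stronglyMeasurable_normMartingale (hX : ∀ i, Measurable (X i))
    (hXi : ∀ i, Integrable (X i) P) (j : Fin (n + 1)) :
    StronglyMeasurable (normMartingale P X j) :=
  ((normMartingale_measurable_headTuple hXi le_rfl).mono (measurable_headTuple hX j).comap_le
    le_rfl).stronglyMeasurable

/-- The past of the martingale is coarser than the past of the summands, so averages over its events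
are controlled by those over events of the first `j` summands. -/
theorem natural_normMartingale_le (hX : ∀ i, Measurable (X i)) (hXi : ∀ i, Integrable (X i) P)
    (j : Fin (n + 1)) :
    Filtration.natural (normMartingale P X) (stronglyMeasurable_normMartingale hX hXi) j ≤
      MeasurableSpace.comap (headTuple X j) inferInstance := by
  refine iSup₂_le fun k hkj => ?_
  exact (normMartingale_measurable_headTuple hXi hkj).comap_le

end Separable

theorem integrable_normMartingale {Ω E : Type*} [MeasurableSpace Ω] [NormedAddCommGroup E]
    {P : Measure Ω} [IsProbabilityMeasure P] {n : ℕ} {X : Fin n → Ω → E}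
    (hXi : ∀ i, Integrable (X i) P)
    (j : Fin (n + 1)) : Integrable (normMartingale P X j) P := by
  have hS : Integrable (headSum X j) P := integrable_finsetSum _ fun i _ => hXi i
  have hlip := lipschitzWith_meanNormAdd (integrable_tailSum hXi j)
  have hi : Integrable (fun ω => meanNormAdd P (tailSum X j) (headSum X j ω) -
      meanNormAdd P (tailSum X j) 0) P := by
    refine hS.mono ((hlip.continuous.comp_aestronglyMeasurable hS.1).sub
      aestronglyMeasurable_const) (.of_forall fun ω => ?_)
    simpa [dist_eq_norm] using hlip.dist_le_mul (headSum X j ω) 0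
  refine (hi.add (integrable_const
    (meanNormAdd P (tailSum X j) 0 - ∫ ω', ‖∑ i, X i ω'‖ ∂P))).congr (.of_forall fun ω => ?_)
  simp [normMartingale]

theorem normMartingale_zero {Ω E : Type*} [MeasurableSpace Ω] [NormedAddCommGroup E] {P : Measure Ω}
    {n : ℕ} {X : Fin n → Ω → E} : normMartingale P X 0 = 0 := by
  ext ω
  simp [normMartingale, meanNormAdd, headSum_zero, tailSum_zero]

theorem normMartingale_last {Ω E : Type*} [MeasurableSpace Ω] [NormedAddCommGroup E] {P : Measure Ω}
    [IsProbabilityMeasure P] {n : ℕ} {X : Fin n → Ω → E} (ω : Ω) :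
    normMartingale P X (Fin.last n) ω = ‖∑ i, X i ω‖ - ∫ ω', ‖∑ i, X i ω'‖ ∂P := by
  simp [normMartingale, meanNormAdd, headSum_last, tailSum_last]

section SeparableMain

variable {Ω : Type u} {E : Type v} [MeasurableSpace Ω] [NormedAddCommGroup E]
  [MeasurableSpace E] [BorelSpace E] [SecondCountableTopology E] {P : Measure Ω}
  [IsProbabilityMeasure P] {n : ℕ} {X : Fin n → Ω → E}

/-- `normMartingale P X j` is a version of the conditional expectation of the centered norm given
the first `j` summands. -/
theorem setIntegral_normMartingale (hX : ∀ i, Measurable (X i)) (hXi : ∀ i, Integrable (X i) P)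
    (hind : iIndepFun X P) (j : Fin (n + 1)) {A : Set Ω}
    (hA : MeasurableSet[MeasurableSpace.comap (headTuple X j) inferInstance] A) :
    ∫ ω in A, normMartingale P X j ω ∂P =
      ∫ ω in A, (‖∑ i, X i ω‖ - ∫ ω', ‖∑ i, X i ω'‖ ∂P) ∂P := by
  obtain ⟨B, hB, rfl⟩ := hA
  have hS : Integrable (fun ω => ∑ i, headTuple X j ω i) P :=
    integrable_finsetSum _ fun i _ => hXi i
  have h := setIntegral_meanNormAdd (s := fun w => ∑ i, w i) (measurable_headTuple hX j)
    (by fun_prop) (measurable_tailSum hX j) (indepFun_headTuple_tailSum hX hind j) hS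
    (integrable_tailSum hXi j) hB
  simp only [← headSum_eq_sum_headTuple, headSum_add_tailSum] at h
  have hc : Integrable (fun _ : Ω => ∫ ω', ‖∑ i, X i ω'‖ ∂P) P := integrable_const _
  have hG : Integrable (fun ω => meanNormAdd P (tailSum X j) (headSum X j ω)) P := by
    refine ((integrable_normMartingale hXi j).add hc).congr (.of_forall fun ω => ?_)
    simp [normMartingale]
  have hN : Integrable (fun ω => ‖∑ i, X i ω‖) P := (integrable_finsetSum _ fun i _ => hXi i).norm
  simp only [normMartingale]
  rw [integral_sub hG.integrableOn hc.integrableOn, integral_sub hN.integrableOn hc.integrableOn, h]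

theorem martingale_normMartingale (hX : ∀ i, Measurable (X i)) (hXi : ∀ i, Integrable (X i) P)
    (hind : iIndepFun X P) :
    Martingale (normMartingale P X)
      (Filtration.natural (normMartingale P X) (stronglyMeasurable_normMartingale hX hXi)) P := by
  set ℱ := Filtration.natural (normMartingale P X) (stronglyMeasurable_normMartingale hX hXi)
  have hadp : StronglyAdapted ℱ (normMartingale P X) := Filtration.stronglyAdapted_natural _
  refine ⟨hadp, fun i j hij => ?_⟩
  refine (ae_eq_condExp_of_forall_setIntegral_eq (ℱ.le i) (integrable_normMartingale hXi j)
    (fun A _ _ => (integrable_normMartingale hXi i).integrableOn) (fun A hA _ => ?_)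
    (hadp i).aestronglyMeasurable).symm
  rw [setIntegral_normMartingale hX hXi hind i (natural_normMartingale_le hX hXi i A hA),
    setIntegral_normMartingale hX hXi hind j
      (natural_normMartingale_le hX hXi j A (ℱ.mono hij A hA))]

/-- Conditional `p`-th moment of the differences of `normMartingale`. -/
theorem setLIntegral_normMartingale_diff_le (hX : ∀ i, Measurable (X i))
    (hXi : ∀ i, Integrable (X i) P) (hind : iIndepFun X P) {p : ℝ} (hp : 0 < p) (i : Fin n) (x : E)
    {A : Set Ω}
    (hA : MeasurableSet[MeasurableSpace.comap (headTuple X i.castSucc) inferInstance] A) :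
    ∫⁻ ω in A, ‖normMartingale P X i.succ ω - normMartingale P X i.castSucc ω‖ₑ ^ p ∂P ≤
      recenteringConstPow p * (∫⁻ ω, ‖X i ω - x‖ₑ ^ p ∂P) * P A := by
  obtain ⟨B, hB, rfl⟩ := hA
  have h := setLIntegral_increment_le hp (s := fun w => ∑ i, w i)
    (measurable_headTuple hX i.castSucc) (by fun_prop) (hX i) (indepFun_headTuple hX hind i) (hXi i)
    (lipschitzWith_meanNormAdd (integrable_tailSum hXi i.succ)) hB x
  convert h using 4 with ω
  rw [← headSum_eq_sum_headTuple, integral_meanNormAdd_add (hX i) (measurable_tailSum hX _) (hXi i)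
    (integrable_tailSum hXi _) (indepFun_tailSum hX hind i), normMartingale, normMartingale,
    headSum_succ, sub_sub_sub_cancel_right]
  congr 2
  rw [show tailSum X i.castSucc = fun ω' => X i ω' + tailSum X i.succ ω' from
    funext fun ω' => tailSum_castSucc X i ω']

/-- The Rosenthal-type bound for the norm of a sum in a separable space. -/
theorem lintegral_norm_sum_sub_mean_rpow_le (hX : ∀ i, Measurable (X i)) (hind : iIndepFun X P)
    (hi : Integrable (fun ω => ‖∑ i, X i ω‖) P) {p : ℝ} (hp : 0 < p) {c₁ c₂ : ℝ≥0}
    (hc : IsMartingaleRosenthal.{u} n p c₁ c₂) (x y : Fin n → E) :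
    ∫⁻ ω, ‖‖∑ i, X i ω‖ - ∫ ω', ‖∑ i, X i ω'‖ ∂P‖ₑ ^ p ∂P ≤
      recenteringConstPow p * c₁ * ∑ i, ∫⁻ ω, ‖X i ω - x i‖ₑ ^ p ∂P +
        c₂ * (∑ i, ∫⁻ ω, ‖X i ω - y i‖ₑ ^ 2 ∂P) ^ (p / 2) := by
  have hXi := integrable_summand hX hind hi
  have h := hc Ω P (normMartingale P X) (stronglyMeasurable_normMartingale hX hXi)
    (martingale_normMartingale hX hXi hind) (by rw [normMartingale_zero])
  simp only [normMartingale_last] at h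
  refine h.trans (add_le_add ?_ ?_)
  · rw [mul_comm (recenteringConstPow p), mul_assoc]
    refine mul_le_mul_right ?_ _
    rw [Finset.mul_sum]
    refine Finset.sum_le_sum fun i _ => ?_
    have := setLIntegral_normMartingale_diff_le hX hXi hind hp i (x i) .univ
    simpa using this
  · gcongr with i
    refine essSup_condLExp_le (Filtration.le _ _) fun A hA => ?_
    have := setLIntegral_normMartingale_diff_le hX hXi hind two_pos i (y i)
      (natural_normMartingale_le hX hXi _ A hA)
    simp only [ENNReal.rpow_two] at this
    refine this.trans ?_
    gcongr
    exact mul_le_of_le_one_left zero_le recenteringConstPow_two_le_one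

end SeparableMain

/-! ### Reduction to a separable space -/

/-- Strongly measurable vectors and finitely many points lie in a common separable subspace. -/
theorem exists_separable_submodule {Ω E ι : Type*} [Countable ι] [MeasurableSpace Ω]
    [NormedAddCommGroup E] [NormedSpace ℝ E] {X : ι → Ω → E} (hX : ∀ i, StronglyMeasurable (X i))
    (x y : ι → E) :
    ∃ F : Submodule ℝ E, SecondCountableTopology F ∧
      (∀ i ω, X i ω ∈ F) ∧ (∀ i, x i ∈ F) ∧ ∀ i, y i ∈ F := by
  set A : Set E := (⋃ i, Set.range (X i)) ∪ (Set.range x ∪ Set.range y)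
  have hA : TopologicalSpace.IsSeparable A := by
    refine .union (.iUnion fun i => (hX i).isSeparable_range) (.union ?_ ?_)
    · exact (Set.countable_range x).isSeparable
    · exact (Set.countable_range y).isSeparable
  have hsub : A ⊆ Submodule.span ℝ A := Submodule.subset_span
  exact ⟨Submodule.span ℝ A, (hA.span (R := ℝ)).secondCountableTopology,
    fun i ω => hsub (.inl (Set.mem_iUnion.2 ⟨i, ω, rfl⟩)), fun i => hsub (.inr (.inl ⟨i, rfl⟩)),
    fun i => hsub (.inr (.inr ⟨i, rfl⟩))⟩

/-- The Rosenthal-type bound for the norm of a sum, without separability. Restricting the range to a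
subspace changes neither the generated σ-algebras nor the norms. -/
theorem lintegral_norm_sum_sub_mean_rpow_le_of_stronglyMeasurable {Ω : Type u} [MeasurableSpace Ω]
    {P : Measure Ω} [IsProbabilityMeasure P]
    {E : Type v} [NormedAddCommGroup E] [NormedSpace ℝ E] [MeasurableSpace E] [BorelSpace E]
    {n : ℕ} {X : Fin n → Ω → E} (hX : ∀ i, StronglyMeasurable (X i)) (hind : iIndepFun X P)
    (hi : Integrable (fun ω => ‖∑ i, X i ω‖) P) {p : ℝ} (hp : 0 < p) {c₁ c₂ : ℝ≥0}
    (hc : IsMartingaleRosenthal.{u} n p c₁ c₂) (x y : Fin n → E) :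
    ∫⁻ ω, ‖‖∑ i, X i ω‖ - ∫ ω', ‖∑ i, X i ω'‖ ∂P‖ₑ ^ p ∂P ≤
      recenteringConstPow p * c₁ * ∑ i, ∫⁻ ω, ‖X i ω - x i‖ₑ ^ p ∂P +
        c₂ * (∑ i, ∫⁻ ω, ‖X i ω - y i‖ₑ ^ 2 ∂P) ^ (p / 2) := by
  obtain ⟨F, _, hXF, hxF, hyF⟩ := exists_separable_submodule hX x y
  set X' : Fin n → Ω → F := fun i ω => ⟨X i ω, hXF i ω⟩
  have hX' : ∀ i, Measurable (X' i) := fun i => (hX i).measurable.subtype_mk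
  have hcomap : ∀ i, MeasurableSpace.comap (X' i) inferInstance =
      MeasurableSpace.comap (X i) inferInstance := fun i =>
    MeasurableSpace.comap_comp
  have hind' : iIndepFun X' P := by
    rw [iIndepFun_iff_iIndep] at hind ⊢
    simpa only [hcomap] using hind
  have hnorm : ∀ ω, ‖∑ i, X' i ω‖ = ‖∑ i, X i ω‖ := fun ω => by
    change ‖((∑ i, X' i ω : F) : E)‖ = _
    rw [Submodule.coe_sum]
  have h := lintegral_norm_sum_sub_mean_rpow_le hX' hind' (by simpa only [hnorm] using hi) hp hc
    (fun i => ⟨x i, hxF i⟩) (fun i => ⟨y i, hyF i⟩)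
  simp only [hnorm] at h
  exact h

theorem mainTheorem5 {Ω : Type u} [MeasurableSpace Ω] (P : Measure Ω)
    [IsProbabilityMeasure P]
    {E : Type v} [NormedAddCommGroup E] [NormedSpace ℝ E] [CompleteSpace E]
    [MeasurableSpace E] [BorelSpace E]
    (n : ℕ) (X : Fin n → Ω → E) (hX : ∀ i, StronglyMeasurable (X i)) (hindep : iIndepFun X P)
    (Y : Ω → ℝ) (hY : ∀ ω, Y ω = ‖∑ i, X i ω‖) (hYint : Integrable Y P) :
    (∀ (p : ℝ), 2 ≤ p → ∀ (c₁ c₂ : ℝ≥0), IsMartingaleRosenthal.{u} n p c₁ c₂ →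
      ∀ x y : Fin n → E,
        ∫⁻ ω, ‖Y ω - ∫ ω', Y ω' ∂P‖ₑ ^ p ∂P ≤
          recenteringConstPow p * c₁ * ∑ i, ∫⁻ ω, ‖X i ω - x i‖ₑ ^ p ∂P +
          c₂ * (∑ i, ∫⁻ ω, ‖X i ω - y i‖ₑ ^ 2 ∂P) ^ (p / 2)) ∧
    (∀ x : Fin n → E, evariance Y P ≤ ∑ i, ∫⁻ ω, ‖X i ω - x i‖ₑ ^ 2 ∂P) := by
  obtain rfl : Y = fun ω => ‖∑ i, X i ω‖ := funext hY
  refine ⟨fun p hp c₁ c₂ hc x y =>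
    lintegral_norm_sum_sub_mean_rpow_le_of_stronglyMeasurable hX hindep hYint (by linarith) hc x y,
    fun x => ?_⟩
  have h := lintegral_norm_sum_sub_mean_rpow_le_of_stronglyMeasurable hX hindep hYint two_pos
    (isMartingaleRosenthal_two n) x x
  simp only [ENNReal.rpow_two, ENNReal.coe_one, mul_one, ENNReal.coe_zero, zero_mul, add_zero] at h
  exact h.trans (mul_le_of_le_one_left zero_le recenteringConstPow_two_le_one)
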